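/- Let $\varepsilon>0$ and $k\ge 1$, and let $h:[0,\infty)\to[0,\infty)$ be continuous and increasing with $h(0)=0$, and such that for some $B>0$ the function $\log h$ is well defined and Lipschitz on $[B,\infty)$. Users are the real numbers $u\in\mathbb R$, and the disutility of user $u$ from a result $a\in\mathbb R$ is $h(|u-a|)$. A mechanism $(Z,\mathbf P,\mathbf Q)$ consists of a measurable space $Z$ of signals, a family $\mathbf P=(P_u)_{u\in\mathbb R}$ of probability measures on $Z$ (user $u$ sends a signal $s\sim P_u$), and a Markov kernel $\mathbf Q=(Q_s)_{s\in Z}$ from $Z$ to $\mathbb R^k$ (on receiving $s$ the server returns $k$ results $a=(a_1,\dots,a_k)\sim Q_s$). Let $\mathcal P^{(\varepsilon)}_Z$ be the set of those $\mathbf P$ that are $\varepsilon$-geographically differentially private, i.e. $P_{u_1}(S)\le e^{\varepsilon|u_1-u_2|}P_{u_2}(S)$ for all $u_1,u_2\in\mathbb R$ and all measurable $S\subseteq Z$. The cost of a mechanism is $$\mathrm{cost}(Z,\mathbf P,\mathbf Q)=\sup_{u\in\mathbb R}\ \mathbb E_{s\sim P_u}\,\mathbb E_{a\sim Q_s}\Big[\min_{1\le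 i\le k}h(|u-a_i|)\Big]\in[0,\infty],$$ and the optimal multi-selection cost is $$f(\varepsilon,k)=\inf_{Z}\ \inf_{\mathbf P\in\mathcal P^{(\varepsilon)}_Z}\ \inf_{\mathbf Q}\ \mathrm{cost}(Z,\mathbf P,\mathbf Q).$$ Let $\mathcal L_\varepsilon(u)$ be the Laplace distribution of scale $1/\varepsilon$ centred at $u$, with density $x\mapsto\frac{\varepsilon}{2}e^{-\varepsilon|x-u|}$, and put $$\hat f(\varepsilon,k)=\min_{a\in\mathbb R^k}\ \mathbb E_{y\sim\mathcal L_\varepsilon(0)}\Big[\min_{1\le i\le k}h(|y-a_i|)\Big].$$ Then the minimum defining $\hat f(\varepsilon,k)$ is attained (possibly with value $\infty$). The Laplace action $\mathbf P^{\mathcal L}=(\mathcal L_\varepsilon(u))_{u\in\mathbb R}$, with signal space $Z=\mathbb R$, belongs to $\mathcal P^{(\varepsilon)}_{\mathbb R}$ and is an optimal choice for the users: $$\inf_{\mathbf Q}\mathrm{cost}(\mathbb R,\mathbf P^{\mathcal L},\mathbf Q)=f(\varepsilon,k),$$ and this infimum is attained by some $\mathbf Q$. Moreover $$f(\varepsilon,k)=\hat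 f(\varepsilon,k).$$ -/

import Mathlib

open MeasureTheory ProbabilityTheory
open scoped ENNReal NNReal

universe v

/-- Admissible disutility profiles: `h` is continuous and increasing on `[0, ∞)`, `h 0 = 0`, and
there is `B > 0` such that `log h` is (well defined and) Lipschitz on `[B, ∞)`.
Only the values of `h` on `[0, ∞)` matter. -/
structure Admissible (h : ℝ → ℝ) : Prop where
  continuousOn : ContinuousOn h (Set.Ici 0)
  monotoneOn : MonotoneOn h (Set.Ici 0)
  map_zero : h 0 = 0
  log_lipschitz : ∃ B : ℝ, 0 < B ∧ (∀ x ∈ Set.Ici B, 0 < h x) ∧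
    ∃ K : ℝ≥0, LipschitzOnWith K (fun x => Real.log (h x)) (Set.Ici B)

/-- The Laplace distribution on `ℝ` of scale `1 / ε` centred at `u`. -/
noncomputable def laplace (ε u : ℝ) : Measure ℝ :=
  volume.withDensity fun x => ENNReal.ofReal (ε / 2 * Real.exp (-ε * |x - u|))

/-- `ε`-geographic differential privacy of a family of distributions on the signal space `Z`,
indexed by the users `u : ℝ`. -/
def GeoDP {Z : Type*} [MeasurableSpace Z] (ε : ℝ) (P : ℝ → Measure Z) : Prop :=
  ∀ u₁ u₂ : ℝ, ∀ S : Set Z, MeasurableSet S →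
    P u₁ S ≤ ENNReal.ofReal (Real.exp (ε * |u₁ - u₂|)) * P u₂ S

/-- The user actions with signal space `Z` that are `ε`-geographically differentially private:
every user sends a random signal in `Z`, and the privacy constraint holds. -/
def userActions (ε : ℝ) (Z : Type*) [MeasurableSpace Z] : Set (ℝ → Measure Z) :=
  {P | (∀ u, IsProbabilityMeasure (P u)) ∧ GeoDP ε P}

/-- The smallest disutility `min_i h(|u - a i|)` of the user `u` among the results
`a 0, …, a (k - 1)`. -/
noncomputable def minDisutility {k : ℕ} (h : ℝ → ℝ) (u : ℝ) (a : Fin k → ℝ) : ℝ≥0∞ :=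
  ⨅ i, ENNReal.ofReal (h |u - a i|)

/-- The cost of the user `u` for user actions `P` and server response `Q`:
`E_{s ∼ P u} E_{a ∼ Q s} min_i h(|u - a i|)`. -/
noncomputable def userCost {Z : Type*} [MeasurableSpace Z] {k : ℕ} (h : ℝ → ℝ)
    (P : ℝ → Measure Z) (Q : Kernel Z (Fin k → ℝ)) (u : ℝ) : ℝ≥0∞ :=
  ∫⁻ s, ∫⁻ a, minDisutility h u a ∂(Q s) ∂(P u)

/-- The cost of a mechanism: the supremum over all users of the cost of the user. -/
noncomputable def cost {Z : Type*} [MeasurableSpace Z] {k : ℕ} (h : ℝ → ℝ)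
    (P : ℝ → Measure Z) (Q : Kernel Z (Fin k → ℝ)) : ℝ≥0∞ :=
  ⨆ u : ℝ, userCost h P Q u

/-- The smallest cost that a server returning `k` results can reach against user actions `P`. -/
noncomputable def bestResponseCost {Z : Type*} [MeasurableSpace Z] (k : ℕ) (h : ℝ → ℝ)
    (P : ℝ → Measure Z) : ℝ≥0∞ :=
  ⨅ (Q : Kernel Z (Fin k → ℝ)) (_ : IsMarkovKernel Q), cost h P Q

/-- The optimal multi-selection cost `f(ε, k)`: the infimum of the cost over all measurable signal
spaces, all private user actions and all server responses. -/
noncomputable def optimalCost (ε : ℝ) (k : ℕ) (h : ℝ → ℝ) : ℝ≥0∞ :=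
  ⨅ (Z : Type v) (_ : MeasurableSpace Z) (P : ℝ → Measure Z) (_ : P ∈ userActions ε Z),
    bestResponseCost k h P

/-- The expected smallest disutility of `k` fixed results `a` for a user drawn from the Laplace
distribution of scale `1 / ε` centred at `0`. -/
noncomputable def laplaceObjective {k : ℕ} (ε : ℝ) (h : ℝ → ℝ) (a : Fin k → ℝ) : ℝ≥0∞ :=
  ∫⁻ y, minDisutility h y a ∂(laplace ε 0)

/-- `f̂(ε, k)`: the optimal value of the placement of `k` points against Laplace noise. -/
noncomputable def fHat (ε : ℝ) (k : ℕ) (h : ℝ → ℝ) : ℝ≥0∞ :=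
  ⨅ a : Fin k → ℝ, laplaceObjective ε h a

open Filter Topology

/-! Upper bound: the server adds fixed offsets `a` to the Laplace signal, and every user then pays
`laplaceObjective ε h a`.

Lower bound: push a private mechanism forward to the results and average the users over a Laplace
prior of small rate `δ`. For fixed results, the resulting weight on users has an `(ε + δ)`-Lipschitz
logarithm, and `fHat_mul_lintegral_le` bounds its mean disutility below by `fHat (ε + δ) k h`. Such
a weight is `exp (-(ε + δ) u)` times a monotone function, so on an upper set it is a mixture of
exponential tails (`setLIntegral_mul_le_of_isUpperSet`). A left tail from `p` and a right tail from
`q ≥ p` have means adding up to at least twice `fHat` (`two_mul_fHat_le_expTail_add`). Hence the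
line splits into an upper set where right tails suffice and a lower set where left tails do
(`lintegral_mul_le_of_expTail`).

Compactness of placements in the extended reals (`exists_laplaceObjective_le`) removes `δ` and also
gives the minimiser. -/

/-! ### Laplace noise and exponential tails -/

/-- The mean of `G` against the exponential distribution of rate `ε` started at `t`. -/
noncomputable def expTail (ε : ℝ) (G : ℝ → ℝ≥0∞) (t : ℝ) : ℝ≥0∞ :=
  ∫⁻ x in Set.Ici 0, G (t + x) * ENNReal.ofReal (ε * Real.exp (-ε * x))

lemma expTail_const {ε : ℝ} (hε : 0 < ε) (c : ℝ≥0∞) (t : ℝ) : expTail ε (fun _ => c) t = c := by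
  unfold expTail
  have hi : IntegrableOn (fun x : ℝ => ε * Real.exp (-ε * x)) (Set.Ioi 0) :=
    (integrableOn_exp_mul_Ioi (neg_lt_zero.2 hε) 0).const_mul ε
  rw [lintegral_const_mul _ (by fun_prop), setLIntegral_congr Ioi_ae_eq_Ici.symm,
    ← ofReal_integral_eq_lintegral_ofReal hi (ae_of_all _ fun x => by positivity),
    integral_const_mul, integral_exp_mul_Ioi (neg_lt_zero.2 hε)]
  simp [hε.ne']

lemma expTail_mono {ε : ℝ} {F G : ℝ → ℝ≥0∞} {s t : ℝ} (h : ∀ x, 0 ≤ x → F (s + x) ≤ G (t + x)) :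
    expTail ε F s ≤ expTail ε G t :=
  setLIntegral_mono' measurableSet_Ici fun x hx => mul_le_mul_left (h x hx) _

lemma lintegral_laplace (ε u : ℝ) {G : ℝ → ℝ≥0∞} (hG : Measurable G) :
    ∫⁻ y, G y ∂laplace ε u =
      ∫⁻ y, G y * ENNReal.ofReal (ε / 2 * Real.exp (-ε * |y - u|)) := by
  rw [laplace, lintegral_withDensity_eq_lintegral_mul _ (by fun_prop) hG]
  exact lintegral_congr fun y => mul_comm _ _

/-- Reflection and translation of Laplace noise. -/
lemma lintegral_laplace_eq_sub (ε u : ℝ) {G : ℝ → ℝ≥0∞} (hG : Measurable G) :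
    ∫⁻ y, G y ∂laplace ε u = ∫⁻ y, G (u - y) ∂laplace ε 0 := by
  rw [lintegral_laplace ε u hG, lintegral_laplace ε 0 (by fun_prop),
    ← lintegral_sub_left_eq_self _ u]
  refine lintegral_congr fun y => ?_
  rw [show u - y - u = -(y - 0) by ring, abs_neg]

lemma two_mul_lintegral_laplace {ε : ℝ} {G : ℝ → ℝ≥0∞} (hG : Measurable G) :
    2 * ∫⁻ y, G y ∂laplace ε 0 = expTail ε G 0 + expTail ε (fun x => G (-x)) 0 := by
  have hm : Measurable fun y : ℝ => G y * ENNReal.ofReal (ε * Real.exp (-ε * |y|)) := by fun_prop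
  have h2 : 2 * ∫⁻ y, G y ∂laplace ε 0 = ∫⁻ y, G y * ENNReal.ofReal (ε * Real.exp (-ε * |y|)) := by
    rw [lintegral_laplace ε 0 hG, ← lintegral_const_mul _ (by fun_prop)]
    refine lintegral_congr fun y => ?_
    rw [mul_left_comm, sub_zero, ← ENNReal.ofReal_ofNat 2, ← ENNReal.ofReal_mul (by norm_num)]
    congr 2
    ring
  have hneg : ∫⁻ y in Set.Iio 0, G y * ENNReal.ofReal (ε * Real.exp (-ε * |y|)) =
      ∫⁻ y in Set.Ioi 0, G (-y) * ENNReal.ofReal (ε * Real.exp (-ε * |y|)) := by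
    have := (Measure.measurePreserving_neg (volume : Measure ℝ)).setLIntegral_comp_preimage
      (measurableSet_Iio (a := (0 : ℝ))) hm
    rw [← this]
    simp
  rw [h2, ← lintegral_add_compl _ (measurableSet_Ici (a := (0 : ℝ))), Set.compl_Ici, hneg,
    setLIntegral_congr Ioi_ae_eq_Ici]
  unfold expTail
  congr 1 <;>
  · refine setLIntegral_congr_fun measurableSet_Ici fun x hx => ?_
    simp only [zero_add, abs_of_nonneg (Set.mem_Ici.1 hx)]

lemma isProbabilityMeasure_laplace {ε : ℝ} (hε : 0 < ε) (u : ℝ) :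
    IsProbabilityMeasure (laplace ε u) := by
  constructor
  have h1 := lintegral_laplace_eq_sub ε u (G := fun _ => 1) measurable_const
  have h2 := two_mul_lintegral_laplace (ε := ε) (G := fun _ => 1) measurable_const
  rw [expTail_const hε, one_add_one_eq_two] at h2
  rw [lintegral_const, one_mul] at h1
  rw [h1]
  simpa using (ENNReal.mul_eq_left (by simp) (by simp)).1 h2

lemma geoDP_laplace {ε : ℝ} (hε : 0 < ε) : GeoDP ε (laplace ε) := by
  intro u₁ u₂ S hS
  rw [laplace, laplace, withDensity_apply _ hS, withDensity_apply _ hS,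
    ← lintegral_const_mul _ (by fun_prop)]
  refine lintegral_mono fun x => ?_
  rw [← ENNReal.ofReal_mul (by positivity)]
  refine ENNReal.ofReal_le_ofReal ?_
  rw [mul_left_comm, ← Real.exp_add]
  gcongr
  nlinarith [abs_sub_le x u₁ u₂, abs_sub_comm x u₁, abs_sub_le u₁ u₂ x,
    abs_sub_le x u₁ u₂, abs_sub_le u₂ u₁ x]

lemma laplace_mem_userActions {ε : ℝ} (hε : 0 < ε) : laplace ε ∈ userActions ε ℝ :=
  ⟨isProbabilityMeasure_laplace hε, geoDP_laplace hε⟩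

/-! ### Weights with Lipschitz logarithm -/

/-- Domination on the half-lines `[t, ∞)` with `t` in an upper set `S` gives domination on `S`. -/
lemma measure_upperSet_le {μ ν : Measure ℝ} {S : Set ℝ} (hS : IsUpperSet S)
    (h : ∀ t ∈ S, μ (Set.Ici t) ≤ ν (Set.Ici t)) : μ S ≤ ν S := by
  by_cases hmin : ∃ t ∈ S, ∀ x ∈ S, t ≤ x
  · obtain ⟨t, ht, hmin⟩ := hmin
    have : S = Set.Ici t := Set.Subset.antisymm hmin fun x hx => hS hx ht
    rw [this]
    exact h t ht
  push Not at hmin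
  -- Without a least element, `S` is a countable directed union of closed half-lines, so continuity
  -- from below applies.
  have hU : S = ⋃ q : {q : ℚ // (q : ℝ) ∈ S}, Set.Ici (q : ℝ) := by
    ext x
    simp only [Set.mem_iUnion, Set.mem_Ici]
    constructor
    · intro hx
      obtain ⟨y, hy, hyx⟩ := hmin x hx
      obtain ⟨q, hq, hqx⟩ := exists_rat_btwn hyx
      exact ⟨⟨q, hS hq.le hy⟩, hqx.le⟩
    · rintro ⟨q, hq⟩
      exact hS hq q.2
  have hd : Directed (· ⊆ ·) fun q : {q : ℚ // (q : ℝ) ∈ S} => Set.Ici (q : ℝ) := by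
    intro p q
    rcases le_total (p : ℝ) (q : ℝ) with hpq | hpq
    · exact ⟨p, subset_rfl, Set.Ici_subset_Ici.2 hpq⟩
    · exact ⟨q, Set.Ici_subset_Ici.2 hpq, subset_rfl⟩
  rw [hU, hd.measure_iUnion, hd.measure_iUnion]
  exact iSup_mono fun q => h _ q.2

/-- By the layer-cake formula only superlevel sets matter, and those of a monotone function are
upper sets. -/
lemma setLIntegral_monotone_le {μ ν : Measure ℝ} {U : Set ℝ} (hU : IsUpperSet U)
    (hμν : ∀ t ∈ U, μ (Set.Ici t) ≤ ν (Set.Ici t)) {m : ℝ → ℝ} (hm : Monotone m)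
    (hm0 : ∀ x, 0 ≤ m x) :
    ∫⁻ x in U, ENNReal.ofReal (m x) ∂μ ≤ ∫⁻ x in U, ENNReal.ofReal (m x) ∂ν := by
  rw [lintegral_eq_lintegral_meas_lt _ (ae_of_all _ hm0) hm.measurable.aemeasurable,
    lintegral_eq_lintegral_meas_lt _ (ae_of_all _ hm0) hm.measurable.aemeasurable]
  refine lintegral_mono fun s => ?_
  have hms : MeasurableSet {a | s < m a} := measurableSet_lt measurable_const hm.measurable
  rw [Measure.restrict_apply hms, Measure.restrict_apply hms]
  refine measure_upperSet_le (IsUpperSet.inter (fun x y hxy hx => lt_of_lt_of_le hx (hm hxy)) hU)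
    fun t ht => hμν t ht.2

/-- If `G` has mean at least `c` against the exponential distribution started at any point of the
upper set `U`, then it has mean at least `c` on `U` against any weight `ρ` whose logarithm is
`ε`-Lipschitz. -/
lemma setLIntegral_mul_le_of_isUpperSet {ε : ℝ} (hε : 0 < ε) {G : ℝ → ℝ≥0∞} (hG : Measurable G)
    {ρ : ℝ → ℝ} (hρ0 : ∀ u, 0 ≤ ρ u) (hρ : ∀ u v, ρ u ≤ Real.exp (ε * |u - v|) * ρ v)
    {U : Set ℝ} (hU : IsUpperSet U) {c : ℝ≥0∞} (hc : ∀ t ∈ U, c ≤ expTail ε G t) :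
    ∫⁻ u in U, c * ENNReal.ofReal (ρ u) ≤ ∫⁻ u in U, G u * ENNReal.ofReal (ρ u) := by
  set w : ℝ → ℝ≥0∞ := fun u => ENNReal.ofReal (Real.exp (-ε * u)) with hw
  have hwm : Measurable w := by fun_prop
  -- The exponential tilt turns the Lipschitz bound on `log ρ` into monotonicity; the factor `w`
  -- goes into the measure.
  set m : ℝ → ℝ := fun u => Real.exp (ε * u) * ρ u with hm
  have hmono : Monotone m := by
    intro x y hxy
    have := hρ x y
    rw [abs_of_nonpos (by linarith)] at this
    calc Real.exp (ε * x) * ρ x ≤ Real.exp (ε * x) * (Real.exp (ε * -(x - y)) * ρ y) := by gcongr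
      _ = Real.exp (ε * y) * ρ y := by
        rw [← mul_assoc, ← Real.exp_add]
        ring_nf
  have hm0 : ∀ x, 0 ≤ m x := fun x => mul_nonneg (Real.exp_pos _).le (hρ0 x)
  have hwρ : ∀ u, w u * ENNReal.ofReal (m u) = ENNReal.ofReal (ρ u) := by
    intro u
    rw [hw, hm, ← ENNReal.ofReal_mul (Real.exp_pos _).le, ← mul_assoc, ← Real.exp_add]
    simp
  have key : ∀ F : ℝ → ℝ≥0∞, Measurable F → ∀ V : Set ℝ, MeasurableSet V →
      ∫⁻ u in V, F u * ENNReal.ofReal (ρ u) =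
        ∫⁻ u in V, ENNReal.ofReal (m u) ∂(volume.withDensity fun u => F u * w u) := by
    intro F hF V hV
    rw [restrict_withDensity hV, lintegral_withDensity_eq_lintegral_mul _ (by fun_prop)
      (hmono.measurable.ennreal_ofReal)]
    refine lintegral_congr fun u => ?_
    rw [Pi.mul_apply, mul_assoc, hwρ]
  have hUm : MeasurableSet U := hU.ordConnected.measurableSet
  rw [key (fun _ => c) measurable_const U hUm, key G hG U hUm]
  refine setLIntegral_monotone_le hU (fun t ht => ?_) hmono hm0
  -- Half-line masses are exponential means up to a factor independent of `F`, so `hc` compares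
  -- them.
  have tail : ∀ F : ℝ → ℝ≥0∞, Measurable F →
      ENNReal.ofReal ε * (volume.withDensity fun u => F u * w u) (Set.Ici t) =
        w t * expTail ε F t := by
    intro F hF
    have hpre : (fun x : ℝ => t + x) ⁻¹' Set.Ici t = Set.Ici 0 := by
      ext x
      simp
    rw [withDensity_apply _ measurableSet_Ici,
      ← (measurePreserving_add_left volume t).setLIntegral_comp_preimage measurableSet_Ici
        (by fun_prop), hpre, expTail, ← lintegral_const_mul _ (by fun_prop),
      ← lintegral_const_mul _ (by fun_prop)]
    refine lintegral_congr fun x => ?_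
    rw [mul_left_comm, mul_left_comm (w t), hw, ← ENNReal.ofReal_mul hε.le,
      ← ENNReal.ofReal_mul (Real.exp_pos _).le, mul_left_comm (Real.exp _), ← Real.exp_add,
      mul_add]
  have hε0 : ENNReal.ofReal ε ≠ 0 := by simpa using hε
  rw [← ENNReal.mul_le_mul_iff_right hε0 ENNReal.ofReal_ne_top, tail _ measurable_const, tail G hG,
    expTail_const hε]
  exact mul_le_mul_right (hc t ht) _

/-- A left tail with mean below `c` at `p` forces right tails with mean at least `c` at every `q ≥
p`. Cut the line there and use the half-line estimate on each side, reflected on the left. -/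
lemma lintegral_mul_le_of_expTail {ε : ℝ} (hε : 0 < ε) {G : ℝ → ℝ≥0∞} (hG : Measurable G)
    {ρ : ℝ → ℝ} (hρ0 : ∀ u, 0 ≤ ρ u) (hρ : ∀ u v, ρ u ≤ Real.exp (ε * |u - v|) * ρ v)
    {c : ℝ≥0∞}
    (hc : ∀ p q, p ≤ q → 2 * c ≤ expTail ε (fun x => G (-x)) (-p) + expTail ε G q) :
    ∫⁻ u, c * ENNReal.ofReal (ρ u) ≤ ∫⁻ u, G u * ENNReal.ofReal (ρ u) := by
  set U : Set ℝ := {q | ∃ p ≤ q, expTail ε (fun x => G (-x)) (-p) < c} with hUdef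
  have hU : IsUpperSet U := fun x y hxy ⟨p, hp, hpc⟩ => ⟨p, hp.trans hxy, hpc⟩
  have hUm : MeasurableSet U := hU.ordConnected.measurableSet
  have hright := setLIntegral_mul_le_of_isUpperSet hε hG hρ0 hρ hU (c := c) (by
    rintro q ⟨p, hpq, hp⟩
    by_contra! hlt
    have := ENNReal.add_lt_add hp hlt
    rw [← two_mul] at this
    exact (hc p q hpq).not_gt this)
  have hV : IsUpperSet (Neg.neg ⁻¹' Uᶜ : Set ℝ) := fun x y hxy hx hy =>
    hx (hU (neg_le_neg hxy) hy)
  have hleft := setLIntegral_mul_le_of_isUpperSet hε (hG.comp measurable_neg)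
    (ρ := fun u => ρ (-u)) (fun u => hρ0 _)
    (fun u v => by
      have := hρ (-u) (-v)
      rwa [show -u - -v = -(u - v) by ring, abs_neg] at this) hV (c := c) (by
    intro t ht
    by_contra! hlt
    refine ht ⟨-t, le_rfl, ?_⟩
    simpa [Function.comp_def] using hlt)
  have refl : ∀ F : ℝ → ℝ≥0∞, ∫⁻ u in Neg.neg ⁻¹' Uᶜ, F (-u) = ∫⁻ u in Uᶜ, F u := fun F =>
    (Measure.measurePreserving_neg (volume : Measure ℝ)).setLIntegral_comp_preimage_emb
      (Homeomorph.neg ℝ).measurableEmbedding F Uᶜ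
  have h1 := refl fun u => c * ENNReal.ofReal (ρ u)
  have h2 := refl fun u => G u * ENNReal.ofReal (ρ u)
  simp only [Function.comp_def] at hleft
  rw [h1, h2] at hleft
  rw [← lintegral_add_compl _ hUm, ← lintegral_add_compl (fun u => G u * _) hUm]
  exact add_le_add hright hleft

/-! ### Disutilities and collapsing an interval -/

namespace Admissible

variable {h : ℝ → ℝ}

lemma continuous_comp_abs (hh : Admissible h) : Continuous fun x => h |x| :=
  hh.continuousOn.comp_continuous continuous_abs fun x => abs_nonneg x

lemma le_of_abs_le (hh : Admissible h) {x y : ℝ} (hxy : |x| ≤ |y|) : h |x| ≤ h |y| :=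
  hh.monotoneOn (abs_nonneg x) (abs_nonneg y) hxy

end Admissible

lemma minDisutility_le_of_abs_le {h : ℝ → ℝ} (hh : Admissible h) {k : ℕ} {u v : ℝ}
    {a b : Fin k → ℝ} (hab : ∀ i, |u - a i| ≤ |v - b i|) :
    minDisutility h u a ≤ minDisutility h v b :=
  iInf_mono fun i => ENNReal.ofReal_le_ofReal (hh.le_of_abs_le (hab i))

lemma minDisutility_congr {h : ℝ → ℝ} {k : ℕ} {u v : ℝ} {a b : Fin k → ℝ}
    (hab : ∀ i, |u - a i| = |v - b i|) : minDisutility h u a = minDisutility h v b :=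
  iInf_congr fun i => by rw [hab i]

lemma measurable_minDisutility {h : ℝ → ℝ} (hh : Admissible h) (k : ℕ) :
    Measurable fun p : ℝ × (Fin k → ℝ) => minDisutility h p.1 p.2 := by
  refine Measurable.iInf fun i => ENNReal.measurable_ofReal.comp ?_
  exact hh.continuous_comp_abs.measurable.comp (by fun_prop)

lemma measurable_minDisutility_left {h : ℝ → ℝ} (hh : Admissible h) {k : ℕ} (a : Fin k → ℝ) :
    Measurable fun u => minDisutility h u a :=
  (measurable_minDisutility hh k).comp (measurable_id.prodMk measurable_const)

lemma measurable_minDisutility_right {h : ℝ → ℝ} (hh : Admissible h) {k : ℕ} (u : ℝ) :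
    Measurable fun a : Fin k → ℝ => minDisutility h u a :=
  (measurable_minDisutility hh k).comp (measurable_const.prodMk measurable_id)

/-- Collapsing the interval `[p, q]` to a point turns the two exponential tails into Laplace
noise without increasing the disutilities. -/
lemma two_mul_fHat_le_expTail_add {ε : ℝ} {h : ℝ → ℝ} (hh : Admissible h) {k : ℕ} (a : Fin k → ℝ)
    {p q : ℝ} (hpq : p ≤ q) :
    2 * fHat ε k h ≤ expTail ε (fun x => minDisutility h (-x) a) (-p) +
      expTail ε (fun x => minDisutility h x a) q := by
  -- Points left of `p` move by `p`, points right of `q` by `q`, and points between them go to `0`.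
  set b : Fin k → ℝ := fun i => min (a i - p) 0 + max (a i - q) 0 with hb
  have hle : fHat ε k h ≤ laplaceObjective ε h b := iInf_le _ b
  refine (mul_le_mul_right hle 2).trans ?_
  rw [laplaceObjective, two_mul_lintegral_laplace (measurable_minDisutility_left hh b), add_comm]
  refine add_le_add (expTail_mono fun x hx => ?_) (expTail_mono fun x hx => ?_) <;>
  · refine minDisutility_le_of_abs_le hh fun i => sq_le_sq.1 ?_
    rcases le_total (a i - p) 0 with h1 | h1 <;> rcases le_total (a i - q) 0 with h2 | h2 <;>
    simp only [hb, min_eq_left h1, min_eq_right h1, max_eq_left h2, max_eq_right h2] <;>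
    nlinarith

/-- The weight `ρ` plays the role of the unnormalised posterior on users given the results `a`. -/
lemma fHat_mul_lintegral_le {ε : ℝ} (hε : 0 < ε) {h : ℝ → ℝ} (hh : Admissible h) {k : ℕ}
    (a : Fin k → ℝ) {ρ : ℝ → ℝ≥0∞} (hρm : Measurable ρ) (hρt : ∀ u, ρ u ≠ ∞)
    (hρ : ∀ u v, ρ u ≤ ENNReal.ofReal (Real.exp (ε * |u - v|)) * ρ v) :
    fHat ε k h * ∫⁻ u, ρ u ≤ ∫⁻ u, minDisutility h u a * ρ u := by
  have := lintegral_mul_le_of_expTail hε (measurable_minDisutility_left hh a)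
    (ρ := fun u => (ρ u).toReal) (fun u => ENNReal.toReal_nonneg)
    (fun u v => by
      have := ENNReal.toReal_mono (ENNReal.mul_ne_top ENNReal.ofReal_ne_top (hρt v)) (hρ u v)
      rwa [ENNReal.toReal_mul, ENNReal.toReal_ofReal (Real.exp_pos _).le] at this)
    (fun p q hpq => two_mul_fHat_le_expTail_add hh a hpq)
  simp only [ENNReal.ofReal_toReal (hρt _)] at this
  rwa [lintegral_const_mul _ hρm] at this

/-! ### Costs of private mechanisms -/

/-- A server response that adds fixed offsets to the Laplace noise. -/
lemma exists_cost_eq_laplaceObjective {Z : Type*} [MeasurableSpace Z] {ε : ℝ} {h : ℝ → ℝ}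
    (hh : Admissible h) {k : ℕ} (a : Fin k → ℝ) {P : ℝ → Measure Z} {e : Z → ℝ}
    (he : Measurable e) (hP : ∀ u, (P u).map e = laplace ε u) :
    ∃ Q : Kernel Z (Fin k → ℝ), IsMarkovKernel Q ∧ cost h P Q = laplaceObjective ε h a := by
  have hf : Measurable fun s : Z => fun i : Fin k => e s + a i := by fun_prop
  refine ⟨Kernel.deterministic _ hf, inferInstance, ?_⟩
  have hu : ∀ u, userCost h P (Kernel.deterministic _ hf) u = laplaceObjective ε h a := by
    intro u
    have hm : Measurable fun y : ℝ => minDisutility h u fun i => y + a i :=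
      (measurable_minDisutility_right hh u).comp (by fun_prop)
    have h1 : userCost h P (Kernel.deterministic _ hf) u =
        ∫⁻ y, minDisutility h u (fun i => y + a i) ∂laplace ε u := by
      rw [← hP u, lintegral_map hm he]
      refine lintegral_congr fun s => ?_
      rw [Kernel.lintegral_deterministic' hf (measurable_minDisutility_right hh u)]
    rw [h1, lintegral_laplace_eq_sub ε u hm, laplaceObjective]
    refine lintegral_congr fun y => minDisutility_congr fun i => ?_
    rw [show u - (u - y + a i) = y - a i by ring]
  simp [cost, hu]

lemma GeoDP.measure_le {Z : Type*} [MeasurableSpace Z] {ε : ℝ} {P : ℝ → Measure Z}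
    (hP : GeoDP ε P) (u v : ℝ) : P u ≤ ENNReal.ofReal (Real.exp (ε * |u - v|)) • P v :=
  Measure.le_iff.2 fun S hS => hP u v S hS

/-- Post-processing preserves geographic differential privacy. -/
lemma GeoDP.bind {Z Y : Type*} [MeasurableSpace Z] [MeasurableSpace Y] {ε : ℝ} {P : ℝ → Measure Z}
    (hP : GeoDP ε P) (Q : Kernel Z Y) : GeoDP ε fun u => (P u).bind Q := by
  intro u v S hS
  rw [Measure.bind_apply hS Q.aemeasurable, Measure.bind_apply hS Q.aemeasurable,
    ← smul_eq_mul, ← lintegral_smul_measure]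
  exact lintegral_mono' (hP.measure_le u v) le_rfl

/-- A private family of probability measures has densities whose logarithms are Lipschitz in the
user. -/
lemma GeoDP.exists_density {Y : Type*} [MeasurableSpace Y] {ε : ℝ} (hε : 0 < ε) {R : ℝ → Measure Y}
    [∀ u, IsProbabilityMeasure (R u)] (hR : GeoDP ε R) :
    ∃ r : ℝ → Y → ℝ≥0∞, Measurable (Function.uncurry r) ∧
      (∀ u, R u = (R 0).withDensity (r u)) ∧
      ∀ u v a, r u a ≤ ENNReal.ofReal (Real.exp (ε * |u - v|)) * r v a := by
  obtain ⟨E, hE⟩ : ∃ E : ℝ → ℝ≥0∞, E = fun x => ENNReal.ofReal (Real.exp (ε * |x|)) := ⟨_, rfl⟩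
  have hEm : Continuous E := by
    rw [hE]
    exact ENNReal.continuous_ofReal.comp (by fun_prop)
  have hE0 : ∀ x, E x ≠ 0 := fun x => by simp [hE, Real.exp_pos]
  have hEt : ∀ x, E x ≠ ∞ := fun x => by simp [hE]
  have hE0' : E 0 = 1 := by simp [hE]
  have hRE : ∀ u v S, MeasurableSet S → R u S ≤ E (u - v) * R v S := fun u v S hS => by
    rw [hE]
    exact hR u v S hS
  have hEE : ∀ u v w, E (u - w) ≤ E (u - v) * E (v - w) := fun u v w => by
    rw [hE, ← ENNReal.ofReal_mul (Real.exp_pos _).le, ← Real.exp_add, ← mul_add]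
    exact ENNReal.ofReal_le_ofReal (Real.exp_le_exp.2
      (mul_le_mul_of_nonneg_left (abs_sub_le u v w) hε.le))
  have hEs : ∀ u v, E (u - v) = E (v - u) := fun u v => by simp only [hE, abs_sub_comm]
  have hac : ∀ u, R u ≪ R 0 := fun u => Measure.absolutelyContinuous_of_le_smul (hR.measure_le u 0)
  set d : ℝ → Y → ℝ≥0∞ := fun v => (R v).rnDeriv (R 0) with hd
  have hdm : ∀ v, Measurable (d v) := fun v => Measure.measurable_rnDeriv _ _
  have hRd : ∀ v, (R 0).withDensity (d v) = R v := fun v => Measure.withDensity_rnDeriv_eq _ _ (hac v)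
  -- A multiplicative McShane regularisation makes the bound hold at every point; rational `v` keep
  -- `r` measurable and the exceptional null sets countable in number.
  set r : ℝ → Y → ℝ≥0∞ := fun u a => ⨅ v : ℚ, E (u - v) * d v a with hr
  have hrm : Measurable (Function.uncurry r) := by
    refine Measurable.iInf fun v => Measurable.mul ?_ ((hdm v).comp measurable_snd)
    exact hEm.measurable.comp (by fun_prop)
  have hrmu : ∀ u, Measurable (r u) := fun u => hrm.comp measurable_prodMk_left
  refine ⟨r, hrm, fun u => ?_, fun u v a => ?_⟩
  · refine le_antisymm ?_ (Measure.le_iff.2 fun S hS => ?_)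
    · nth_rewrite 1 [← hRd u]
      refine withDensity_mono ?_
      have : ∀ᵐ a ∂(R 0), ∀ v : ℚ, d u a ≤ E (u - v) * d v a := by
        refine ae_all_iff.2 fun v => ?_
        refine ae_le_of_forall_setLIntegral_le_of_sigmaFinite (hdm u) fun S hS _ => ?_
        rw [lintegral_const_mul _ (hdm v), ← withDensity_apply _ hS, ← withDensity_apply _ hS,
          hRd, hRd]
        exact hRE u v S hS
      filter_upwards [this] with a ha using le_iInf ha
    · have hq : ∀ v : ℚ, (R 0).withDensity (r u) S ≤ E (u - v) * (E (u - v) * R u S) := by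
        intro v
        calc (R 0).withDensity (r u) S = ∫⁻ a in S, r u a ∂(R 0) := withDensity_apply _ hS
          _ ≤ ∫⁻ a in S, E (u - v) * d v a ∂(R 0) := lintegral_mono fun a => iInf_le _ v
          _ = E (u - v) * R v S := by
            rw [lintegral_const_mul _ (hdm v), ← withDensity_apply _ hS, hRd]
          _ ≤ _ := by
            rw [hEs u v]
            exact mul_le_mul_right (hRE v u S hS) _
      have hcont : Continuous fun w : ℝ => E (u - w) * (E (u - w) * R u S) := by
        have hEc : Continuous fun w : ℝ => E (u - w) := hEm.comp (by fun_prop)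
        refine continuous_iff_continuousAt.2 fun w => ?_
        refine ENNReal.Tendsto.mul hEc.continuousAt (Or.inl (hE0 _)) ?_ (Or.inr (hEt _))
        exact ENNReal.Tendsto.mul_const hEc.continuousAt (Or.inl (hE0 _))
      have hclosed : IsClosed {w : ℝ | (R 0).withDensity (r u) S ≤ E (u - w) * (E (u - w) * R u S)} :=
        isClosed_le continuous_const hcont
      have := Rat.denseRange_cast.induction_on
        (p := fun w : ℝ => (R 0).withDensity (r u) S ≤ E (u - w) * (E (u - w) * R u S)) u hclosed hq
      simpa [hE0'] using this
  · rw [show ENNReal.ofReal (Real.exp (ε * |u - v|)) = E (u - v) by rw [hE]]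
    simp only [hr]
    rw [ENNReal.mul_iInf_of_ne (hE0 _) (hEt _)]
    refine iInf_mono fun w => ?_
    rw [← mul_assoc]
    exact mul_le_mul_left (hEE u v w) _

/-- Averaging the users against a wide Laplace distribution bounds the cost of any private
mechanism from below. -/
lemma fHat_add_le_cost {Z : Type*} [MeasurableSpace Z] {ε δ : ℝ} (hε : 0 < ε) (hδ : 0 < δ)
    {h : ℝ → ℝ} (hh : Admissible h) {k : ℕ} {P : ℝ → Measure Z} (hP : P ∈ userActions ε Z)
    (Q : Kernel Z (Fin k → ℝ)) [IsMarkovKernel Q] : fHat (ε + δ) k h ≤ cost h P Q := by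
  have hPp : ∀ u, IsProbabilityMeasure (P u) := hP.1
  set R : ℝ → Measure (Fin k → ℝ) := fun u => (P u).bind Q with hRdef
  have hRp : ∀ u, IsProbabilityMeasure (R u) := fun u =>
    isProbabilityMeasure_bind Q.aemeasurable (ae_of_all _ inferInstance)
  obtain ⟨r, hrm, hRr, hrL⟩ := (hP.2.bind Q).exists_density hε
  change ∀ u, R u = (R 0).withDensity (r u) at hRr
  have hru : ∀ u, Measurable (r u) := fun u => hrm.comp measurable_prodMk_left
  have hra : ∀ a, Measurable fun u => r u a := fun a => hrm.comp measurable_prodMk_right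
  have hcost : ∀ u, userCost h P Q u = ∫⁻ a, minDisutility h u a * r u a ∂(R 0) := by
    intro u
    calc userCost h P Q u = ∫⁻ a, minDisutility h u a ∂(R u) :=
          (Measure.lintegral_bind Q.aemeasurable
            (measurable_minDisutility_right hh u).aemeasurable).symm
      _ = _ := by
          rw [hRr u, lintegral_withDensity_eq_lintegral_mul _ (hru u)
            (measurable_minDisutility_right hh u)]
          exact lintegral_congr fun a => mul_comm _ _
  have hone : ∀ u, ∫⁻ a, r u a ∂(R 0) = 1 := by
    intro u
    have := measure_univ (μ := R u)
    rwa [hRr u, withDensity_apply _ MeasurableSet.univ, Measure.restrict_univ] at this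
  -- Finiteness at user `0` passes to all users by `hrL`, so a single null set suffices.
  have hfin : ∀ᵐ a ∂(R 0), r 0 a < ∞ := ae_lt_top (hru 0) (by simp [hone])
  -- A probability prior is needed because Lebesgue measure on users is infinite; its price is the
  -- extra `δ` in the rate.
  set w : ℝ → ℝ≥0∞ := fun u => ENNReal.ofReal (δ / 2 * Real.exp (-δ * |u|)) with hw
  have hwm : Measurable w := by fun_prop
  have hw1 : ∫⁻ u, w u = 1 := by
    have := (isProbabilityMeasure_laplace hδ 0).measure_univ
    rw [laplace, withDensity_apply _ MeasurableSet.univ, Measure.restrict_univ] at this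
    simpa only [sub_zero] using this
  have hwL : ∀ u v, w u ≤ ENNReal.ofReal (Real.exp (δ * |u - v|)) * w v := by
    intro u v
    simp only [hw]
    rw [← ENNReal.ofReal_mul (Real.exp_pos _).le, mul_left_comm, ← Real.exp_add]
    refine ENNReal.ofReal_le_ofReal ?_
    gcongr
    nlinarith [abs_sub_abs_le_abs_sub v u, abs_sub_comm u v]
  have hpoint : ∀ᵐ a ∂(R 0), fHat (ε + δ) k h * ∫⁻ u, r u a * w u ≤
      ∫⁻ u, minDisutility h u a * (r u a * w u) := by
    filter_upwards [hfin] with a ha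
    refine fHat_mul_lintegral_le (add_pos hε hδ) hh a ((hra a).mul hwm)
      (fun u => ENNReal.mul_ne_top (ne_top_of_le_ne_top
        (ENNReal.mul_ne_top ENNReal.ofReal_ne_top ha.ne) (hrL u 0 a)) ENNReal.ofReal_ne_top)
      fun u v => (mul_le_mul' (hrL u v a) (hwL u v)).trans_eq ?_
    rw [mul_mul_mul_comm, ← ENNReal.ofReal_mul (Real.exp_pos _).le, ← Real.exp_add, add_mul]
  have hswap1 : ∫⁻ a, (∫⁻ u, r u a * w u) ∂(R 0) = 1 := by
    rw [lintegral_lintegral_swap]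
    · simp only [lintegral_mul_const _ (hru _), hone, one_mul, hw1]
    · exact ((hrm.comp measurable_swap).mul (hwm.comp measurable_snd)).aemeasurable
  calc fHat (ε + δ) k h = ∫⁻ a, fHat (ε + δ) k h * (∫⁻ u, r u a * w u) ∂(R 0) := by
        rw [lintegral_const_mul, hswap1, mul_one]
        exact ((hrm.comp measurable_swap).mul (hwm.comp measurable_snd)).lintegral_prod_right'
    _ ≤ ∫⁻ a, (∫⁻ u, minDisutility h u a * (r u a * w u)) ∂(R 0) := lintegral_mono_ae hpoint
    _ = ∫⁻ u, ∫⁻ a, minDisutility h u a * (r u a * w u) ∂(R 0) := by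
        refine lintegral_lintegral_swap ?_
        exact (((measurable_minDisutility hh k).comp measurable_swap).mul
          ((hrm.comp measurable_swap).mul (hwm.comp measurable_snd))).aemeasurable
    _ = ∫⁻ u, userCost h P Q u * w u := by
        refine lintegral_congr fun u => ?_
        have hm : Measurable fun a => minDisutility h u a * r u a :=
          (measurable_minDisutility_right hh u).mul (hru u)
        rw [hcost, ← lintegral_mul_const _ hm]
        simp only [mul_assoc]
    _ ≤ ∫⁻ u, cost h P Q * w u := lintegral_mono fun u =>
        mul_le_mul_left (le_iSup (userCost h P Q) u) _
    _ = cost h P Q := by rw [lintegral_const_mul _ hwm, hw1, mul_one]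

/-! ### Compactness and the limit of rates -/

/-- Results that converge in the extended reals can be replaced by real results without increasing
the limiting disutility. -/
lemma minDisutility_le_liminf {h : ℝ → ℝ} (hh : Admissible h) {k : ℕ} {a : ℕ → Fin k → ℝ}
    {b : Fin k → EReal} (hab : Tendsto (fun n i => ((a n i : ℝ) : EReal)) atTop (𝓝 b)) (y : ℝ) :
    minDisutility h y (fun i => (b i).toReal) ≤
      liminf (fun n => minDisutility h y (a n)) atTop := by
  refine le_of_forall_lt fun c hc => ?_
  obtain ⟨c', hcc', hc'⟩ := exists_between hc
  refine hcc'.trans_le (le_liminf_of_le (by isBoundedDefault) ?_)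
  have hi : ∀ i, ∀ᶠ n in atTop, c' ≤ ENNReal.ofReal (h |y - a n i|) := by
    intro i
    have hlt : c' < ENNReal.ofReal (h |y - (b i).toReal|) := hc'.trans_le (iInf_le _ i)
    have hlim : Tendsto (fun n => ((a n i : ℝ) : EReal)) atTop (𝓝 (b i)) :=
      (continuous_apply i).continuousAt.tendsto.comp hab
    -- An infinite limit has `toReal` equal to `0`; the escaping results are eventually at least as
    -- far from `y` as `0` is.
    have hfar : (∀ᶠ n in atTop, |y| ≤ |y - a n i|) → (b i).toReal = 0 →
        ∀ᶠ n in atTop, c' ≤ ENNReal.ofReal (h |y - a n i|) := by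
      intro hn h0
      rw [h0, sub_zero] at hlt
      filter_upwards [hn] with n hn
      exact hlt.le.trans (ENNReal.ofReal_le_ofReal (hh.le_of_abs_le hn))
    induction hb : b i with
    | bot =>
      rw [hb] at hlim
      refine hfar ?_ (by simp [hb])
      filter_upwards [EReal.tendsto_nhds_bot_iff_real.1 hlim (y - |y|)] with n hn
      have : a n i < y - |y| := by exact_mod_cast hn
      linarith [le_abs_self (y - a n i)]
    | top =>
      rw [hb] at hlim
      refine hfar ?_ (by simp [hb])
      filter_upwards [EReal.tendsto_nhds_top_iff_real.1 hlim (y + |y|)] with n hn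
      have : y + |y| < a n i := by exact_mod_cast hn
      linarith [neg_abs_le (y - a n i)]
    | coe x =>
      rw [hb] at hlim hlt
      have hx : Tendsto (fun n => a n i) atTop (𝓝 x) := EReal.tendsto_coe.1 hlim
      have : Tendsto (fun n => ENNReal.ofReal (h |y - a n i|)) atTop
          (𝓝 (ENNReal.ofReal (h |y - x|))) :=
        ENNReal.tendsto_ofReal ((hh.continuous_comp_abs.tendsto _).comp (hx.const_sub y))
      exact (this.eventually (lt_mem_nhds hlt)).mono fun n hn => hn.le
  filter_upwards [eventually_all.2 hi] with n hn using le_iInf hn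

/-- Compactness: placements that are good for Laplace noise of nearby scales yield a placement
that is good in the limit. -/
lemma exists_laplaceObjective_le {h : ℝ → ℝ} (hh : Admissible h) {k : ℕ} {ε : ℝ}
    {e : ℕ → ℝ} (he : Tendsto e atTop (𝓝 ε)) {C : ℝ≥0∞} (hC : ∀ n, fHat (e n) k h ≤ C) :
    ∃ a : Fin k → ℝ, laplaceObjective ε h a ≤ C := by
  rcases eq_or_ne C ∞ with rfl | hCt
  · exact ⟨0, le_top⟩
  have hex : ∀ n : ℕ, ∃ a : Fin k → ℝ, laplaceObjective (e n) h a < C + ((n : ℝ≥0∞) + 1)⁻¹ :=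
    fun n => iInf_lt_iff.1 ((hC n).trans_lt (ENNReal.lt_add_right hCt (by simp)))
  choose a ha using hex
  obtain ⟨b, φ, hφ, hb⟩ := CompactSpace.tendsto_subseq fun n i => ((a n i : ℝ) : EReal)
  refine ⟨fun i => (b i).toReal, ?_⟩
  set W : ℝ → ℝ → ℝ≥0∞ := fun s y => ENNReal.ofReal (s / 2 * Real.exp (-s * |y - 0|)) with hW
  have hobj : ∀ s (a : Fin k → ℝ), laplaceObjective s h a = ∫⁻ y, minDisutility h y a * W s y :=
    fun s a => lintegral_laplace s 0 (measurable_minDisutility_left hh a)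
  have heφ : Tendsto (fun n => e (φ n)) atTop (𝓝 ε) := he.comp hφ.tendsto_atTop
  have hWlim : ∀ y, Tendsto (fun n => W (e (φ n)) y) atTop (𝓝 (W ε y)) := by
    intro y
    have : Continuous fun s : ℝ => W s y := ENNReal.continuous_ofReal.comp (by fun_prop)
    exact (this.tendsto ε).comp heφ
  have hpt : ∀ y, minDisutility h y (fun i => (b i).toReal) * W ε y ≤
      liminf (fun n => minDisutility h y (a (φ n)) * W (e (φ n)) y) atTop := by
    intro y
    refine le_trans ?_ ENNReal.le_liminf_mul
    rw [(hWlim y).liminf_eq]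
    exact mul_le_mul_left (minDisutility_le_liminf hh hb y) _
  have hClim : Tendsto (fun n : ℕ => C + ((φ n : ℝ≥0∞) + 1)⁻¹) atTop (𝓝 C) := by
    have h0 : Tendsto (fun n : ℕ => ((n : ℝ≥0∞) + 1)⁻¹) atTop (𝓝 0) := by
      have := (tendsto_add_atTop_iff_nat 1).2 ENNReal.tendsto_inv_nat_nhds_zero
      simpa using this
    simpa using (h0.comp hφ.tendsto_atTop).const_add C
  rw [hobj]
  calc _ ≤ ∫⁻ y, liminf (fun n => minDisutility h y (a (φ n)) * W (e (φ n)) y) atTop :=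
        lintegral_mono hpt
    _ ≤ liminf (fun n => ∫⁻ y, minDisutility h y (a (φ n)) * W (e (φ n)) y) atTop :=
        lintegral_liminf_le fun n => (measurable_minDisutility_left hh _).mul (by fun_prop)
    _ ≤ liminf (fun n : ℕ => C + ((φ n : ℝ≥0∞) + 1)⁻¹) atTop := by
        refine liminf_le_liminf (Eventually.of_forall fun n => ?_)
        rw [← hobj]
        exact (ha (φ n)).le
    _ = C := hClim.liminf_eq

/-! ### Optimality of Laplace noise -/

/-- For every signal universe: Laplace noise is a private user action; its best-response cost is
the optimal multi-selection cost, and some server response attains it; the optimal cost equals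
`fHat`, and the infimum that defines `fHat` is attained. -/
theorem theorem4 (ε : ℝ) (hε : 0 < ε) (k : ℕ) (hk : 1 ≤ k) (h : ℝ → ℝ) (hh : Admissible h) :
    laplace ε ∈ userActions ε ℝ ∧
    bestResponseCost k h (laplace ε) = optimalCost.{v} ε k h ∧
    (∃ Q : Kernel ℝ (Fin k → ℝ), IsMarkovKernel Q ∧
      cost h (laplace ε) Q = optimalCost.{v} ε k h) ∧
    optimalCost.{v} ε k h = fHat ε k h ∧
    ∃ a : Fin k → ℝ, laplaceObjective ε h a = fHat ε k h := by
  have hL := laplace_mem_userActions hε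
  have hδ : ∀ n : ℕ, (0 : ℝ) < 1 / (n + 1) := fun n => Nat.one_div_pos_of_nat
  have he : Tendsto (fun n : ℕ => ε + 1 / ((n : ℝ) + 1)) atTop (𝓝 ε) := by
    simpa using tendsto_one_div_add_atTop_nhds_zero_nat.const_add ε
  have hopt : fHat ε k h ≤ optimalCost.{v} ε k h := by
    obtain ⟨a, ha⟩ := exists_laplaceObjective_le hh he (C := optimalCost.{v} ε k h) fun n =>
      le_iInf fun Z => le_iInf fun _ => le_iInf fun P => le_iInf fun hP => le_iInf fun Q =>
        le_iInf fun _ => fHat_add_le_cost hε (hδ n) hh hP Q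
    exact (iInf_le _ a).trans ha
  -- This does not follow from `hopt`: `ℝ` need not lie in universe `v`.
  have hbest : fHat ε k h ≤ bestResponseCost k h (laplace ε) := by
    obtain ⟨a, ha⟩ := exists_laplaceObjective_le hh he (C := bestResponseCost k h (laplace ε))
      fun n => le_iInf fun Q => le_iInf fun _ => fHat_add_le_cost hε (hδ n) hh hL Q
    exact (iInf_le _ a).trans ha
  -- Attainment: offset responses realise each `laplaceObjective ε h a` as a cost, so `fHat` at rate
  -- `ε + δ` is at most `fHat` at rate `ε`.
  obtain ⟨a, ha⟩ := exists_laplaceObjective_le hh he (C := fHat ε k h) fun n =>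
    le_iInf fun a => by
      obtain ⟨Q, hQ, hQa⟩ := exists_cost_eq_laplaceObjective hh a (P := laplace ε) measurable_id
        fun u => Measure.map_id
      exact hQa ▸ fHat_add_le_cost hε (hδ n) hh hL Q
  have haf : laplaceObjective ε h a = fHat ε k h := le_antisymm ha (iInf_le _ a)
  obtain ⟨Q, hQ, hQa⟩ := exists_cost_eq_laplaceObjective hh a (P := laplace ε) measurable_id
    fun u => Measure.map_id
  have hbest' : bestResponseCost k h (laplace ε) = fHat ε k h :=
    le_antisymm ((iInf₂_le Q hQ).trans_eq (hQa.trans haf)) hbest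
  have hopt' : optimalCost.{v} ε k h = fHat ε k h := by
    refine le_antisymm ?_ hopt
    have hup : Measurable (ULift.up : ℝ → ULift.{v} ℝ) := measurable_up
    have hmem : (fun u => (laplace ε u).map (ULift.up : ℝ → ULift.{v} ℝ)) ∈
        userActions ε (ULift.{v} ℝ) := by
      refine ⟨fun u => ?_, fun u₁ u₂ S hS => ?_⟩
      · have := hL.1 u
        exact Measure.isProbabilityMeasure_map hup.aemeasurable
      · rw [Measure.map_apply hup hS, Measure.map_apply hup hS]
        exact hL.2 u₁ u₂ _ (hup hS)
    obtain ⟨Q', hQ', hQa'⟩ := exists_cost_eq_laplaceObjective hh a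
      (P := fun u => (laplace ε u).map (ULift.up : ℝ → ULift.{v} ℝ)) (e := ULift.down)
      measurable_down fun u => by
        rw [Measure.map_map measurable_down hup]
        exact Measure.map_id
    calc optimalCost.{v} ε k h ≤ bestResponseCost k h _ :=
          iInf_le_of_le (ULift.{v} ℝ) (iInf_le_of_le inferInstance (iInf₂_le _ hmem))
      _ ≤ _ := iInf₂_le Q' hQ'
      _ = fHat ε k h := hQa'.trans haf
  exact ⟨hL, hbest'.trans hopt'.symm, ⟨Q, hQ, hQa.trans (haf.trans hopt'.symm)⟩, hopt', a, haf⟩
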